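/- Let $\mathbf{Grph}$ be the category of directed multigraphs (loops and parallel edges allowed; graphs may be infinite), i.e. functors from $s,t\colon E\rightrightarrows V$ to $\mathbf{Set}$, with graph homomorphisms as arrows. A *contraction map* is a graph homomorphism $f\colon G\to H$, surjective on vertices and on edges, such that for every vertex $v$ of $H$ the subgraph of $G$ induced on the vertices mapped to $v$ is connected (directions of edges ignored). Write $\mathsf{cc}(K)$ for the graph obtained from $K$ by identifying any two vertices in the same connected component and keeping all edges. A map $f\colon G\to H$ is a *$\mathsf{cc}$-contraction* if it is a pushout of the quotient map $K\to\mathsf{cc}(K)$ along some monomorphism $K\hookrightarrow G$. A (possibly infinite) *tree* is a graph that is a tree when the directions of its edges are forgotten. A *tree decomposition* of $G$ of shape a tree $J$ is a family $(B_x)_{x\in V(J)}$ of sets of vertices of $G$ such that every vertex of $G$ lies in some $B_x$, the two ends of every edge of $G$ lie in a common $B_x$, and for every vertex $v$ of $G$ the set $\{x : v\in B_x\}$ induces a connected (nonempty) subgraph of $J$. Its width is $\sup_x |B_x|$, and the tree-width of $G$ is the least width of its tree decompositions (values in $\mathbb N\cup\{\infty\}$). Let $\int J$ be the category whose objects are the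 vertices and the edges of $J$ and whose non-identity arrows are $e\to s(e)$ and $e\to t(e)$, one of each for every edge $e$. A *structured decomposition* of $G$ of shape $J$ is a functor $d\colon\int J\to\mathbf{Grph}$ all of whose arrows are monic, with a colimit cocone $\Lambda$ to $G$; its width is $\sup_{x\in V(J)}|V(d(x))|$. Let $f\colon G\twoheadrightarrow H$ be an epimorphism in $\mathbf{Grph}$. 1. The map $f$ is a contraction map if and only if every tree decomposition $(B_x)_{x\in V(J)}$ of $G$ can be pushed forward along $f$: the family $(f(B_x))_{x\in V(J)}$ is a tree decomposition of $H$ of the same shape $J$, and its width is at most that of $(B_x)$. In particular, if $f$ is a contraction map then the tree-width of $H$ is at most that of $G$. 2. The following are equivalent: (a) $f$ is a $\mathsf{cc}$-contraction; (b) $f$ is a contraction map that is injective on edges; (c) every tree-shaped structured decomposition $(d,\Lambda)$ of $G$ can be pushed forward along $f$: the diagram of images of the maps $f\circ\Lambda_i\colon d(i)\to H$, with the inclusions, is a structured decomposition of $H$ of the same shape, and its width is at most that of $d$. In both parts it is equivalent to require the pushing forward only for decompositions whose shape is a finite tree. -/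

import Mathlib

open CategoryTheory CategoryTheory.Limits

universe u

namespace GraphDecomp

/-! ## The category of graphs -/

/-- The category `Grph` of directed multigraphs (loops and parallel edges allowed): functors to sets
from the schema `s, t : E ⟶ V`, i.e. from the walking parallel pair with `E` the object `zero`,
`V` the object `one`, `s` the arrow `left` and `t` the arrow `right`. Arrows are natural
transformations, i.e. graph homomorphisms. -/
abbrev Grph : Type (u + 1) := WalkingParallelPair ⥤ Type u

/-- The vertices of a graph. -/
abbrev Grph.V (G : Grph.{u}) : Type u := G.obj WalkingParallelPair.one

/-- The edges of a graph. -/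
abbrev Grph.E (G : Grph.{u}) : Type u := G.obj WalkingParallelPair.zero

/-- The source of an edge. -/
abbrev Grph.src (G : Grph.{u}) (e : G.E) : G.V := G.map WalkingParallelPairHom.left e

/-- The target of an edge. -/
abbrev Grph.tgt (G : Grph.{u}) (e : G.E) : G.V := G.map WalkingParallelPairHom.right e

/-- The action of a homomorphism on vertices. -/
abbrev vmap {G H : Grph.{u}} (f : G ⟶ H) (x : G.V) : H.V := f.app WalkingParallelPair.one x

/-- The action of a homomorphism on edges. -/
abbrev emap {G H : Grph.{u}} (f : G ⟶ H) (e : G.E) : H.E := f.app WalkingParallelPair.zero e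

/-- The simple graph on the vertices of `G` in which two distinct vertices are adjacent when some
edge of `G`, in either direction, joins them. -/
def Grph.underlying (G : Grph.{u}) : SimpleGraph G.V where
  Adj x y := x ≠ y ∧ ∃ e : G.E, (G.src e = x ∧ G.tgt e = y) ∨ (G.src e = y ∧ G.tgt e = x)
  symm := ⟨fun _ _ h => ⟨h.1.symm, h.2.imp fun _ he => he.symm⟩⟩
  loopless := ⟨fun _ h => h.1 rfl⟩

/-- A graph is a tree when, forgetting the directions of its edges, it is a tree: no loops, no two
edges with the same pair of ends, and (nonempty) connected and without cycles. -/
structure Grph.IsTree (J : Grph.{u}) : Prop where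
  no_loops : ∀ e : J.E, J.src e ≠ J.tgt e
  no_parallel : Function.Injective fun e : J.E => s(J.src e, J.tgt e)
  isTree : J.underlying.IsTree

/-- A tree with finitely many vertices. -/
def Grph.IsFiniteTree (J : Grph.{u}) : Prop := J.IsTree ∧ Finite J.V

/-! ## Contractions -/

/-- A contraction map: a surjective homomorphism such that the preimage of every vertex is a
connected subgraph. -/
structure IsContraction {G H : Grph.{u}} (f : G ⟶ H) : Prop where
  surjective_vertices : Function.Surjective (vmap f)
  surjective_edges : Function.Surjective (emap f)
  connected : ∀ v : H.V, (G.underlying.induce {x | vmap f x = v}).Connected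

/-- The graph obtained from `G` by identifying any two vertices in the same connected component;
the edges are those of `G` (and become loops). -/
def Grph.cc (G : Grph.{u}) : Grph.{u} :=
  parallelPair (X := G.E) (Y := G.underlying.ConnectedComponent)
    (TypeCat.ofHom fun e => G.underlying.connectedComponentMk (G.src e))
    (TypeCat.ofHom fun e => G.underlying.connectedComponentMk (G.tgt e))

/-- The quotient homomorphism `G ⟶ cc G`, the identity on edges. -/
def Grph.toCC (G : Grph.{u}) : G ⟶ G.cc where
  app x := match x with
    | WalkingParallelPair.zero => 𝟙 G.E
    | WalkingParallelPair.one => TypeCat.ofHom fun v => G.underlying.connectedComponentMk v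
  naturality := by
    rintro X _ (_ | _ | _)
    · rfl
    · rfl
    · have h₁ : G.map (WalkingParallelPairHom.id X) = 𝟙 _ := G.map_id X
      have h₂ : G.cc.map (WalkingParallelPairHom.id X) = 𝟙 _ := G.cc.map_id X
      exact (congrArg (· ≫ _) h₁).trans
        ((Category.id_comp _).trans ((Category.comp_id _).symm.trans (congrArg (_ ≫ ·) h₂.symm)))

/-- `f : G ⟶ H` is the contraction of `G` along a subobject `i : K ↪ G` with respect to connected
components: a pushout of `K ⟶ cc K` along `i`. -/
def IsCCContraction {G H : Grph.{u}} (f : G ⟶ H) : Prop :=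
  ∃ (K : Grph.{u}) (i : K ⟶ G) (j : K.cc ⟶ H), Mono i ∧ IsPushout i K.toCC f j

/-! ## Tree decompositions and their widths -/

/-- The family of vertex sets `bag x`, indexed by the vertices `x` of `J`, satisfies the axioms of a
decomposition of `G` of shape `J`: every vertex of `G` is in a bag, the ends of every edge are
in a common bag, and for every vertex `v` of `G` the `x` with `v ∈ bag x` induce a connected subgraph
of `J`. It is a tree decomposition when `J` is a tree. -/
structure IsDecomposition (G J : Grph.{u}) (bag : J.V → Set G.V) : Prop where
  vertices : ∀ v : G.V, ∃ x, v ∈ bag x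
  edges : ∀ e : G.E, ∃ x, G.src e ∈ bag x ∧ G.tgt e ∈ bag x
  connected : ∀ v : G.V, (J.underlying.induce {x | v ∈ bag x}).Connected

/-- The width of a family of bags: the maximum size of a bag. -/
noncomputable def bagWidth {G J : Grph.{u}} (bag : J.V → Set G.V) : ℕ∞ := ⨆ x, (bag x).encard

/-- The tree-width of `G`: the least width of a tree decomposition of `G`, where width is the maximum
size of a bag. -/
noncomputable def treeWidth (G : Grph.{u}) : ℕ∞ :=
  sInf {w | ∃ (J : Grph.{u}) (bag : J.V → Set G.V),
    J.IsTree ∧ IsDecomposition G J bag ∧ w = bagWidth bag}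

/-- Every decomposition of `G` whose shape satisfies `P` is pushed forward along `f`: the images of
the bags form a decomposition of `H` of the same shape, of at most the same width. -/
def PushesDecompositions (P : Grph.{u} → Prop) {G H : Grph.{u}} (f : G ⟶ H) : Prop :=
  ∀ (J : Grph.{u}), P J → ∀ bag : J.V → Set G.V, IsDecomposition G J bag →
    IsDecomposition H J (fun x => vmap f '' bag x) ∧
      bagWidth (G := H) (fun x => vmap f '' bag x) ≤ bagWidth bag

/-! ## Structured decompositions

The category of elements `J.Elements` of a graph `J` has as objects the vertices and the edges of
`J`, and, besides identities, two arrows `e ⟶ src e` and `e ⟶ tgt e` for every edge `e`. -/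

/-- `d` is a structured decomposition of shape `J` (all its arrows are monic) and decomposes `G`
through the cocone `c`: `c` exhibits `G` as the colimit of `d`. -/
structure IsStructuredDecomposition {J : Grph.{u}} (d : J.Elements ⥤ Grph.{u}) (G : Grph.{u})
    (c : d ⟶ (Functor.const J.Elements).obj G) : Prop where
  mono : ∀ {a b : J.Elements} (φ : a ⟶ b), Mono (d.map φ)
  colimit : Nonempty (IsColimit (Cocone.mk G c))

/-- The width of a structured decomposition of graphs: the maximum number of vertices of a bag, the
bags being the graphs assigned to the vertices of the shape. -/
noncomputable def width {J : Grph.{u}} (d : J.Elements ⥤ Grph.{u}) : ℕ∞ :=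
  ⨆ x : J.V, ENat.card (d.obj (J.elementsMk WalkingParallelPair.one x)).V

/-- The inclusions between the images of the legs of a cocone. -/
theorem range_le_range {J : Grph.{u}} {d : J.Elements ⥤ Grph.{u}} {H : Grph.{u}}
    (c : d ⟶ (Functor.const J.Elements).obj H) {a b : J.Elements} (φ : a ⟶ b) :
    Subfunctor.range (c.app a) ≤ Subfunctor.range (c.app b) := by
  rintro U _ ⟨y, rfl⟩
  refine ⟨(d.map φ).app U y, ?_⟩
  have h : d.map φ ≫ c.app b = c.app a := by simp
  rw [← h]
  rfl

/-- The diagram of images of a cocone `c` over `d`: it sends `a` to the image of the leg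
`c.app a : d.obj a ⟶ H`, a subgraph of `H`, and arrows to inclusions of subgraphs. -/
def imageDiagram {J : Grph.{u}} (d : J.Elements ⥤ Grph.{u}) {H : Grph.{u}}
    (c : d ⟶ (Functor.const J.Elements).obj H) : J.Elements ⥤ Grph.{u} where
  obj a := (Subfunctor.range (c.app a)).toFunctor
  map φ := Subfunctor.homOfLe (range_le_range c φ)

/-- The cocone over the diagram of images formed by the inclusions of the images. -/
def imageCocone {J : Grph.{u}} (d : J.Elements ⥤ Grph.{u}) {H : Grph.{u}}
    (c : d ⟶ (Functor.const J.Elements).obj H) :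
    imageDiagram d c ⟶ (Functor.const J.Elements).obj H where
  app a := (Subfunctor.range (c.app a)).ι

/-- Every structured decomposition of `G` whose shape satisfies `P` is pushed forward along `f`: the
diagram of images of the colimit cocone followed by `f` is, through the inclusions, a structured
decomposition of `H` of the same shape, of at most the same width. -/
def PushesStructuredDecompositions (P : Grph.{u} → Prop) {G H : Grph.{u}} (f : G ⟶ H) : Prop :=
  ∀ (J : Grph.{u}), P J → ∀ (d : J.Elements ⥤ Grph.{u})
    (c : d ⟶ (Functor.const J.Elements).obj G), IsStructuredDecomposition d G c →
      IsStructuredDecomposition (imageDiagram d (c ≫ (Functor.const J.Elements).map f)) H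
          (imageCocone d (c ≫ (Functor.const J.Elements).map f)) ∧
        width (imageDiagram d (c ≫ (Functor.const J.Elements).map f)) ≤ width d

end GraphDecomp

/-!
# Contraction maps push tree decompositions forward

Both equivalences rest on the fibres of `f`.

If `f` is a contraction map and `B` a decomposition of `G` of shape `J`, then the part of `J` where a
vertex `v` of `H` occurs is the union, over the vertices `u` in the fibre of `v`, of the connected
parts where `u` occurs. The fibre is connected and the ends of an edge share a bag, so this union is
connected (`IsContraction.isDecomposition_image`). For structured decompositions the same idea is
used through universal properties: a cocone on the diagram of images induces a homomorphism out of
`G`, which is constant along the edges in a fibre of `f`; if moreover `f` is injective on edges, it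
factors through `f` (`IsContraction.nonempty_isColimit_imageCocone`).

Conversely, decompositions on a single shape are enough, the star with two leaves, a path on three
vertices. A pair `P`, `Q` that covers `G` gives a decomposition with `P` and `Q` at the leaves and
`P ∩ Q` at the centre, and pushing it forward means that `f(P) ∩ f(Q) ⊆ f(P ∩ Q)`. If a fibre of `f`
were the union of two parts without an edge between them, the complements of these parts would be a
pair violating this inclusion (`connected_fibre_of_separations`). For structured decompositions, `P`
and `Q` may also differ in edges only, which gives injectivity on edges
(`injective_emap_of_pushesStructuredDecompositions`).

A pushout of `K ⟶ cc K` along `K ↪ G` does not identify edges, and identifies vertices only along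
edges of `K`, which stay in a fibre; this is seen by testing its universal property against graphs
obtained from `G` by relabelling vertices (`exists_comp_eq_toRelabel`). Conversely, a contraction map
injective on edges is the pushout for `K` the subgraph of the edges that `f` makes loops, whose
components are the fibres of `f` (`IsContraction.isCCContraction`).
-/

namespace GraphDecomp

/-! ### Homomorphisms of graphs -/

/-- A homomorphism of graphs from its actions on vertices and on edges. -/
def Grph.homMk {G H : Grph.{u}} (φ : G.V → H.V) (ψ : G.E → H.E)
    (hs : ∀ e, φ (G.src e) = H.src (ψ e)) (ht : ∀ e, φ (G.tgt e) = H.tgt (ψ e)) : G ⟶ H where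
  app
    | WalkingParallelPair.zero => TypeCat.ofHom ψ
    | WalkingParallelPair.one => TypeCat.ofHom φ
  naturality := by
    rintro X _ (_ | _ | _)
    · ext e; exact hs e
    · ext e; exact ht e
    · have h₁ : G.map (WalkingParallelPairHom.id X) = 𝟙 _ := G.map_id X
      have h₂ : H.map (WalkingParallelPairHom.id X) = 𝟙 _ := H.map_id X
      rw [h₁, h₂, Category.id_comp, Category.comp_id]

theorem vmap_src {G H : Grph.{u}} (f : G ⟶ H) (e : G.E) :
    vmap f (G.src e) = H.src (emap f e) :=
  NatTrans.naturality_apply f WalkingParallelPairHom.left e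

theorem vmap_tgt {G H : Grph.{u}} (f : G ⟶ H) (e : G.E) :
    vmap f (G.tgt e) = H.tgt (emap f e) :=
  NatTrans.naturality_apply f WalkingParallelPairHom.right e

theorem app_surjective {G H : Grph.{u}} (f : G ⟶ H) [Epi f] (k : WalkingParallelPair) :
    Function.Surjective (f.app k) :=
  surjective_of_epi (f.app k)

/-- An epimorphism of graphs is the quotient by its kernel pair: a homomorphism constant on its
fibres factors through it. -/
theorem exists_comp_eq_of_epi {G H W : Grph.{u}} (f : G ⟶ H) [Epi f] (g : G ⟶ W)
    (hg : ∀ k x y, f.app k x = f.app k y → g.app k x = g.app k y) : ∃ h : H ⟶ W, f ≫ h = g := by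
  have key : ∀ k x, g.app k (Function.surjInv (app_surjective f k) (f.app k x)) = g.app k x :=
    fun k x => hg k _ _ (Function.surjInv_eq _ _)
  refine ⟨⟨fun k => TypeCat.ofHom fun y => g.app k (Function.surjInv (app_surjective f k) y),
    fun k l φ => ?_⟩, ?_⟩
  · ext y
    obtain ⟨x, rfl⟩ := app_surjective f k y
    change g.app l (Function.surjInv _ (H.map φ (f.app k x))) =
      W.map φ (g.app k (Function.surjInv _ (f.app k x)))
    rw [key, ← NatTrans.naturality_apply f, key, NatTrans.naturality_apply g]
  · ext k x
    exact key k x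

/-! ### Connectedness of induced subgraphs -/

theorem Grph.eq_of_reachable (G : Grph.{u}) {α : Sort*} (r : G.V → α)
    (hr : ∀ e, r (G.src e) = r (G.tgt e)) {a b : G.V} (h : G.underlying.Reachable a b) :
    r a = r b := by
  obtain ⟨w⟩ := h
  induction w with
  | nil => rfl
  | cons h _ ih =>
    obtain ⟨-, e, ⟨rfl, rfl⟩ | ⟨rfl, rfl⟩⟩ := h
    · exact (hr e).trans ih
    · exact (hr e).symm.trans ih

theorem Grph.reachable_src_tgt (G : Grph.{u}) (e : G.E) :
    G.underlying.Reachable (G.src e) (G.tgt e) := by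
  by_cases h : G.src e = G.tgt e
  · rw [h]
  · exact SimpleGraph.Adj.reachable ⟨h, e, .inl ⟨rfl, rfl⟩⟩

/-- A set of vertices induces a preconnected subgraph if and only if every property of vertices that
is invariant along the edges inside the set holds everywhere or nowhere on it. -/
theorem Grph.preconnected_induce_iff (G : Grph.{u}) (S : Set G.V) :
    (G.underlying.induce S).Preconnected ↔
      ∀ p : G.V → Prop,
        (∀ e, G.src e ∈ S → G.tgt e ∈ S → (p (G.src e) ↔ p (G.tgt e))) →
          ∀ a ∈ S, ∀ b ∈ S, p a → p b := by
  constructor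
  · intro h p hp a ha b hb
    obtain ⟨w⟩ := h ⟨a, ha⟩ ⟨b, hb⟩
    suffices ∀ x y : S, (G.underlying.induce S).Walk x y → p x → p y from this _ _ w
    intro x y w
    induction w with
    | nil => exact id
    | @cons x y _ h _ ih =>
      obtain ⟨-, e, ⟨h₁, h₂⟩ | ⟨h₁, h₂⟩⟩ := h
      all_goals
        have := hp e (by rw [h₁]; exact Subtype.prop _) (by rw [h₂]; exact Subtype.prop _)
        rw [h₁, h₂] at this
        intro hx
        exact ih (by first | exact this.1 hx | exact this.2 hx)
  · rintro h ⟨a, ha⟩ ⟨b, hb⟩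
    have := h (fun x => ∃ hx : x ∈ S, (G.underlying.induce S).Reachable ⟨a, ha⟩ ⟨x, hx⟩) ?_ a ha b hb
      ⟨ha, .refl _⟩
    · exact this.2
    · intro e hs ht
      have : (G.underlying.induce S).Reachable ⟨G.src e, hs⟩ ⟨G.tgt e, ht⟩ := by
        by_cases hne : G.src e = G.tgt e
        · simp only [hne]; rfl
        · exact SimpleGraph.Adj.reachable ⟨hne, e, .inl ⟨rfl, rfl⟩⟩
      exact ⟨fun ⟨_, hx⟩ => ⟨ht, hx.trans this⟩, fun ⟨_, hx⟩ => ⟨hs, hx.trans this.symm⟩⟩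

/-- If every separation of `G` into two vertex sets, with no edge from one side to the other outside
of their intersection, is preserved by `f`, then the fibres of `f` are connected: a disconnected
fibre `A ⊔ B` is separated by the complements of `A` and of `B`. -/
theorem connected_fibre_of_separations {G H : Grph.{u}} (f : G ⟶ H)
    (hf : Function.Surjective (vmap f))
    (h : ∀ P Q : Set G.V, P ∪ Q = Set.univ →
      (∀ e, (G.src e ∈ P ∧ G.tgt e ∈ P) ∨ (G.src e ∈ Q ∧ G.tgt e ∈ Q)) →
        vmap f '' P ∩ vmap f '' Q ⊆ vmap f '' (P ∩ Q)) (v : H.V) :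
    (G.underlying.induce {x | vmap f x = v}).Connected := by
  obtain ⟨x₀, hx₀⟩ := hf v
  refine (SimpleGraph.connected_iff _).2
    ⟨(G.preconnected_induce_iff _).2 fun p hp a ha b hb hpa => ?_, ⟨x₀, hx₀⟩⟩
  by_contra hpb
  obtain ⟨w, hw, hwv⟩ := h {x | vmap f x = v → p x} {x | vmap f x = v → ¬ p x}
    (by ext x; simp only [Set.mem_union, Set.mem_ofPred_eq, Set.mem_univ, iff_true]; tauto)
    (fun e => by
      have := hp e
      simp only [Set.mem_ofPred_eq] at this ⊢
      tauto)
    (show v ∈ _ from ⟨⟨a, fun _ => hpa, ha⟩, ⟨b, fun _ => hpb, hb⟩⟩)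
  exact hw.2 hwv (hw.1 hwv)

/-! ### The star -/

/-- The star with one leaf `some x` for every `x : ι`, joined by an edge to the centre `none`. -/
def Grph.star (ι : Type u) : Grph.{u} :=
  parallelPair (X := ι) (Y := Option ι) (TypeCat.ofHom some) (TypeCat.ofHom fun _ => none)

theorem Grph.star_isTree (ι : Type u) : (Grph.star ι).IsTree where
  no_loops e := Option.some_ne_none (α := ι) e
  no_parallel e e' h := by
    rcases Sym2.eq_iff.1 h with ⟨h, -⟩ | ⟨h, -⟩
    · exact Option.some_injective ι h
    · exact absurd h (Option.some_ne_none (α := ι) e)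
  isTree := by
    have : (Grph.star ι).underlying = SimpleGraph.starGraph (none : Option ι) := by
      ext x y
      refine Iff.trans ?_ SimpleGraph.starGraph_adj.symm
      refine and_congr_right fun hne => ⟨?_, ?_⟩
      · rintro ⟨e, ⟨-, h⟩ | ⟨-, h⟩⟩
        · exact .inr h.symm
        · exact .inl h.symm
      · rintro (rfl | rfl)
        · obtain ⟨e, rfl⟩ := Option.ne_none_iff_exists.1 (Ne.symm hne)
          exact ⟨e, .inr ⟨rfl, rfl⟩⟩
        · obtain ⟨e, rfl⟩ := Option.ne_none_iff_exists.1 hne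
          exact ⟨e, .inl ⟨rfl, rfl⟩⟩
    rw [this]
    exact SimpleGraph.isTree_starGraph _

theorem Grph.star_isFiniteTree (ι : Type u) [Finite ι] : (Grph.star ι).IsFiniteTree :=
  ⟨star_isTree ι, inferInstanceAs (Finite (Option ι))⟩

/-! ### Pushing tree decompositions forward -/

/-- The images of the bags of a decomposition of any shape, tree or not, form a decomposition. -/
theorem IsContraction.isDecomposition_image {G H : Grph.{u}} {f : G ⟶ H} (hf : IsContraction f)
    {J : Grph.{u}} {bag : J.V → Set G.V} (hbag : IsDecomposition G J bag) :
    IsDecomposition H J (fun x => vmap f '' bag x) where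
  vertices v := by
    obtain ⟨u, rfl⟩ := hf.surjective_vertices v
    exact (hbag.vertices u).imp fun x hx => ⟨u, hx, rfl⟩
  edges e := by
    obtain ⟨e, rfl⟩ := hf.surjective_edges e
    obtain ⟨x, hs, ht⟩ := hbag.edges e
    exact ⟨x, ⟨_, hs, vmap_src f e⟩, ⟨_, ht, vmap_tgt f e⟩⟩
  connected v := by
    have hT := fun u p => (J.preconnected_induce_iff _).1 (hbag.connected u).preconnected p
    refine (SimpleGraph.connected_iff _).2 ⟨(J.preconnected_induce_iff _).2 ?_, ?_⟩
    · rintro p hp x ⟨u, hux, hu⟩ y ⟨u', huy, hu'⟩ hpx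
      -- The set for `v` is the union of the connected sets of the vertices `u` in the fibre of `v`,
      -- and those of the two ends of an edge meet.
      have hp' : ∀ u, vmap f u = v → ∀ e, u ∈ bag (J.src e) → u ∈ bag (J.tgt e) →
          (p (J.src e) ↔ p (J.tgt e)) :=
        fun u hu e hs ht => hp e ⟨u, hs, hu⟩ ⟨u, ht, hu⟩
      refine (G.preconnected_induce_iff _).1 (hf.connected v).preconnected
        (fun u => ∀ z, u ∈ bag z → p z) (fun e hs ht => ?_) u hu u' hu'
        (fun z hz => hT u p (hp' u hu) x hux z hz hpx) y huy
      obtain ⟨z, hsz, htz⟩ := hbag.edges e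
      exact ⟨fun h w hw => hT _ p (hp' _ ht) z htz w hw (h z hsz),
        fun h w hw => hT _ p (hp' _ hs) z hsz w hw (h z htz)⟩
    · obtain ⟨u, hu⟩ := hf.surjective_vertices v
      obtain ⟨x, hx⟩ := hbag.vertices u
      exact ⟨x, u, hx, hu⟩

theorem bagWidth_image_le {G H J : Grph.{u}} (f : G ⟶ H) (bag : J.V → Set G.V) :
    bagWidth (G := H) (fun x => vmap f '' bag x) ≤ bagWidth bag :=
  iSup_mono fun _ => Set.encard_image_le _ _

theorem IsContraction.pushesDecompositions {G H : Grph.{u}} {f : G ⟶ H} (hf : IsContraction f)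
    (P : Grph.{u} → Prop) : PushesDecompositions P f :=
  fun _ _ bag hbag => ⟨hf.isDecomposition_image hbag, bagWidth_image_le f bag⟩

theorem IsContraction.treeWidth_le {G H : Grph.{u}} {f : G ⟶ H} (hf : IsContraction f) :
    treeWidth H ≤ treeWidth G := by
  refine le_sInf ?_
  rintro _ ⟨J, bag, hJ, hbag, rfl⟩
  refine le_trans (sInf_le ?_) (bagWidth_image_le f bag)
  exact ⟨J, _, hJ, hf.isDecomposition_image hbag, rfl⟩

/-- A value on the vertices of the star with two leaves. -/
def starFamily {α : Type*} (a b c : α) : (Grph.star (ULift.{u} Bool)).V → α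
  | some ⟨true⟩ => a
  | some ⟨false⟩ => b
  | none => c

/-- A separation `P, Q` of `G` is a tree decomposition with bags `P`, `P ∩ Q`, `Q` on the star with
two leaves. -/
theorem isDecomposition_star {G : Grph.{u}} {P Q : Set G.V} (hPQ : P ∪ Q = Set.univ)
    (he : ∀ e, (G.src e ∈ P ∧ G.tgt e ∈ P) ∨ (G.src e ∈ Q ∧ G.tgt e ∈ Q)) :
    IsDecomposition G (Grph.star (ULift.{u} Bool)) (starFamily P Q (P ∩ Q)) where
  vertices v := by
    rcases hPQ.ge (Set.mem_univ v) with h | h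
    · exact ⟨some ⟨true⟩, h⟩
    · exact ⟨some ⟨false⟩, h⟩
  edges e := by
    rcases he e with h | h
    · exact ⟨some ⟨true⟩, h⟩
    · exact ⟨some ⟨false⟩, h⟩
  connected v := by
    refine (SimpleGraph.connected_iff _).2 ⟨(Grph.preconnected_induce_iff _ _).2 ?_, ?_⟩
    · intro p hp
      by_cases hv : v ∈ P ∧ v ∈ Q
      · have h : ∀ x, p x ↔ p none
          | some ⟨true⟩ => hp ⟨true⟩ hv.1 hv
          | some ⟨false⟩ => hp ⟨false⟩ hv.2 hv
          | none => .rfl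
        exact fun a _ b _ hpa => (h b).2 ((h a).1 hpa)
      · rintro (_ | ⟨_ | _⟩) ha (_ | ⟨_ | _⟩) hb hpa
        all_goals first
          | exact hpa
          | exact absurd ha hv
          | exact absurd hb hv
          | exact absurd (show v ∈ P ∧ v ∈ Q from ⟨ha, hb⟩) hv
          | exact absurd (show v ∈ P ∧ v ∈ Q from ⟨hb, ha⟩) hv
    · rcases hPQ.ge (Set.mem_univ v) with h | h
      · exact ⟨some ⟨true⟩, h⟩
      · exact ⟨some ⟨false⟩, h⟩

/-- Pushing forward the tree decompositions given by separations of `G` already forces the fibres to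
be connected. -/
theorem isContraction_of_pushesDecompositions {G H : Grph.{u}} (f : G ⟶ H) [Epi f]
    (hf : PushesDecompositions Grph.IsFiniteTree f) : IsContraction f where
  surjective_vertices := app_surjective f _
  surjective_edges := app_surjective f _
  connected := by
    refine connected_fibre_of_separations f (app_surjective f _) fun P Q hPQ he v hv => ?_
    by_contra hn
    -- Otherwise the two leaves, but not the centre, have `v` in their bag.
    have h := (hf _ (Grph.star_isFiniteTree _) _ (isDecomposition_star hPQ he)).1.connected v
    refine absurd ((Grph.preconnected_induce_iff _ _).1 h.preconnected (· = some ⟨true⟩)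
      (fun _ _ ht => absurd ht hn) (some ⟨true⟩) hv.1 (some ⟨false⟩) hv.2 rfl) fun h => ?_
    exact Bool.false_ne_true (ULift.up.inj (Option.some.inj h))

/-! ### Contractions with respect to connected components -/

/-- The graph with the edges of `G` whose vertices are relabelled by `r`. -/
def Grph.relabel (G : Grph.{u}) {α : Type u} (r : G.V → α) : Grph.{u} :=
  parallelPair (X := G.E) (Y := α) (TypeCat.ofHom fun e => r (G.src e))
    (TypeCat.ofHom fun e => r (G.tgt e))

/-- The homomorphism from `G` to a relabelled graph, the identity on edges. -/
def Grph.toRelabel (G : Grph.{u}) {α : Type u} (r : G.V → α) : G ⟶ G.relabel r :=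
  Grph.homMk r id (fun _ => rfl) fun _ => rfl

/-- A relabelling of `G` that is constant along the edges of the subgraph `K` factors through the
pushout of `K ⟶ cc K`. -/
theorem exists_comp_eq_toRelabel {G H K : Grph.{u}} {f : G ⟶ H} {i : K ⟶ G} {j : K.cc ⟶ H}
    (h : IsPushout i K.toCC f j) {α : Type u} (r : G.V → α)
    (hr : ∀ e : K.E, r (vmap i (K.src e)) = r (vmap i (K.tgt e))) :
    ∃ g : H ⟶ G.relabel r, f ≫ g = G.toRelabel r := by
  let b : K.cc ⟶ G.relabel r := Grph.homMk
    (fun c : K.underlying.ConnectedComponent =>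
      c.lift (fun v => r (vmap i v)) fun v w p _ => K.eq_of_reachable (fun v => r (vmap i v)) hr ⟨p⟩)
    (show K.E → G.E from fun e => emap i e) (fun e => congrArg r (vmap_src i e))
    fun e => congrArg r (vmap_tgt i e)
  have hb : i ≫ G.toRelabel r = K.toCC ≫ b := by
    ext (_ | _) x <;> rfl
  exact ⟨h.desc _ _ hb, h.inl_desc _ _ hb⟩

/-- Collapsing all vertices of `G` to one point and keeping the edges is a homomorphism that factors
through `f`. -/
theorem IsCCContraction.injective_emap {G H : Grph.{u}} {f : G ⟶ H} (hf : IsCCContraction f) :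
    Function.Injective (emap f) := by
  obtain ⟨K, i, j, -, h⟩ := hf
  obtain ⟨g, hg⟩ := exists_comp_eq_toRelabel h (fun _ => PUnit.unit) fun _ => rfl
  have hg' : ∀ e, emap g (emap f e) = e := fun e => congrArg (fun φ => emap φ e) hg
  exact fun e e' h => (hg' e).symm.trans ((congrArg (emap g) h).trans (hg' e'))

theorem IsCCContraction.isContraction {G H : Grph.{u}} {f : G ⟶ H} [Epi f]
    (hf : IsCCContraction f) : IsContraction f where
  surjective_vertices := app_surjective f _
  surjective_edges := app_surjective f _
  connected v := by
    obtain ⟨K, i, j, -, h⟩ := hf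
    have hK : ∀ e : K.E, vmap f (G.src (emap i e)) = vmap f (G.tgt (emap i e)) := by
      intro e
      have hw : ∀ x, vmap f (vmap i x) = vmap j (K.underlying.connectedComponentMk x) :=
        fun x => congrArg (fun φ => vmap φ x) h.w
      rw [← vmap_src, ← vmap_tgt, hw, hw,
        SimpleGraph.ConnectedComponent.sound (K.reachable_src_tgt e)]
    obtain ⟨x₀, hx₀⟩ := app_surjective f _ v
    refine (SimpleGraph.connected_iff _).2
      ⟨(G.preconnected_induce_iff _).2 fun p hp a ha b hb hpa => ?_, ⟨x₀, hx₀⟩⟩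
    -- Edges of `K` stay in a fibre of `f`, so an invariant property of the fibre is a relabelling
    -- of `G` that factors through `f`.
    obtain ⟨g, hg⟩ := exists_comp_eq_toRelabel h
      (fun x => ULift.up.{u} (vmap f x = v ∧ p x)) fun e => by
        rw [vmap_src, vmap_tgt, hK]
        congr 1
        refine propext (and_congr_right fun ht => ?_)
        exact hp _ ((hK e).trans ht) ht
    have hg' : ∀ x, vmap g (vmap f x) = ULift.up.{u} (vmap f x = v ∧ p x) :=
      fun x => congrArg (fun φ => vmap φ x) hg
    have hab : ULift.up.{u} (vmap f a = v ∧ p a) = ULift.up.{u} (vmap f b = v ∧ p b) :=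
      (hg' a).symm.trans ((congrArg (vmap g) (Eq.trans ha (Eq.symm hb))).trans (hg' b))
    exact ((ULift.up.inj hab).mp ⟨ha, hpa⟩).2

/-- The subgraph of `G` with all its vertices and the edges whose ends are identified by `f`. -/
def edgeKernel {G H : Grph.{u}} (f : G ⟶ H) : Grph.{u} :=
  parallelPair (X := {e : G.E // vmap f (G.src e) = vmap f (G.tgt e)}) (Y := G.V)
    (TypeCat.ofHom fun e => G.src e.1) (TypeCat.ofHom fun e => G.tgt e.1)

/-- The inclusion of the subgraph of edges whose ends are identified by `f`. -/
def edgeKernelι {G H : Grph.{u}} (f : G ⟶ H) : edgeKernel f ⟶ G :=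
  Grph.homMk id Subtype.val (fun _ => rfl) fun _ => rfl

instance {G H : Grph.{u}} (f : G ⟶ H) : Mono (edgeKernelι f) := by
  have : ∀ k, Mono ((edgeKernelι f).app k) := by
    rintro (_ | _)
    · exact (mono_iff_injective _).2 Subtype.val_injective
    · exact (mono_iff_injective _).2 Function.injective_id
  exact NatTrans.mono_of_mono_app _

/-- A contraction map injective on edges is the pushout of `K ⟶ cc K` for `K` the subgraph of all
vertices and of the edges that `f` makes loops: the components of `K` are the fibres of `f`. -/
theorem IsContraction.isCCContraction {G H : Grph.{u}} {f : G ⟶ H} [Epi f] (hf : IsContraction f)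
    (hinj : Function.Injective (emap f)) : IsCCContraction f := by
  let K := edgeKernel f
  have hK : ∀ e : K.E, vmap f (K.src e) = vmap f (K.tgt e) := fun e => e.2
  have hreach : ∀ x y : G.V, vmap f x = vmap f y → K.underlying.Reachable x y := by
    intro x y hxy
    refine (G.preconnected_induce_iff _).1 (hf.connected (vmap f y)).preconnected
      (fun z => K.underlying.Reachable x z) (fun e hs ht => ?_) x hxy y rfl (.refl _)
    have := K.reachable_src_tgt
      (show {e // vmap f (G.src e) = vmap f (G.tgt e)} from ⟨e, hs.trans ht.symm⟩)
    exact ⟨fun h => h.trans this, fun h => h.trans this.symm⟩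
  let j : K.cc ⟶ H := Grph.homMk
    (fun c : K.underlying.ConnectedComponent =>
      c.lift (vmap f) fun v w p _ => K.eq_of_reachable (fun x => vmap f x) hK ⟨p⟩)
    (fun e : K.E => emap f e.1) (fun e => vmap_src f e.1) fun e => vmap_tgt f e.1
  have hsq : edgeKernelι f ≫ f = K.toCC ≫ j := by
    ext (_ | _) x <;> rfl
  have hepi : Epi K.toCC := by
    have : ∀ k, Epi (K.toCC.app k) := by
      rintro (_ | _)
      · exact (epi_iff_surjective _).2 Function.surjective_id
      · exact (epi_iff_surjective _).2 Quot.mk_surjective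
    exact NatTrans.epi_of_epi_app _
  refine ⟨K, edgeKernelι f, j, inferInstance, ⟨⟨hsq⟩, ⟨PushoutCocone.isColimitAux' _ fun s => ?_⟩⟩⟩
  have hs : ∀ x : G.V, vmap s.inl x = vmap s.inr (K.underlying.connectedComponentMk x) :=
    fun x => congrArg (fun φ : K ⟶ s.pt => vmap φ (show K.V from x)) s.condition
  have hex : ∃ h : H ⟶ s.pt, f ≫ h = s.inl := by
    refine exists_comp_eq_of_epi f s.inl ?_
    rintro (_ | _) x y hxy
    · exact congrArg _ (hinj hxy)
    · exact (hs x).trans ((congrArg (vmap s.inr)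
        (SimpleGraph.ConnectedComponent.sound (hreach x y hxy))).trans (hs y).symm)
  refine ⟨hex.choose, hex.choose_spec, ?_, fun {m} hm _ => ?_⟩
  · change j ≫ _ = _
    rw [← cancel_epi K.toCC, ← Category.assoc, ← hsq, Category.assoc, hex.choose_spec]
    exact s.condition
  · exact (cancel_epi f).1 (hm.trans hex.choose_spec.symm)

/-! ### Pushing structured decompositions forward -/

theorem exists_app_eq_of_isColimit {J : Grph.{u}} {d : J.Elements ⥤ Grph.{u}} {c : Cocone d}
    (hc : IsColimit c) {k : WalkingParallelPair} (x : c.pt.obj k) :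
    ∃ a y, (c.ι.app a).app k y = x :=
  Types.jointly_surjective_of_isColimit
    (isColimitOfPreserves ((evaluation WalkingParallelPair (Type u)).obj k) hc) x

theorem width_imageDiagram_le {J : Grph.{u}} (d : J.Elements ⥤ Grph.{u}) {H : Grph.{u}}
    (c : d ⟶ (Functor.const J.Elements).obj H) : width (imageDiagram d c) ≤ width d := by
  refine iSup_mono fun x => ?_
  let a := J.elementsMk WalkingParallelPair.one x
  calc (Set.range (vmap (c.app a))).encard
      = (vmap (c.app a) '' Set.univ).encard := by rw [Set.image_univ]
    _ ≤ (Set.univ : Set (d.obj a).V).encard := Set.encard_image_le _ _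
    _ = ENat.card (d.obj a).V := Set.encard_univ _

instance {J : Grph.{u}} (d : J.Elements ⥤ Grph.{u}) {H : Grph.{u}}
    (c : d ⟶ (Functor.const J.Elements).obj H) {a b : J.Elements} (φ : a ⟶ b) :
    Mono ((imageDiagram d c).map φ) :=
  inferInstanceAs (Mono (Subfunctor.homOfLe (range_le_range (a := a) (b := b) c φ)))

/-- The corestriction of a cocone to the diagram of its images. -/
def toImageDiagram {J : Grph.{u}} (d : J.Elements ⥤ Grph.{u}) {H : Grph.{u}}
    (c : d ⟶ (Functor.const J.Elements).obj H) : d ⟶ imageDiagram d c where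
  app a := Subfunctor.toRange (c.app a)
  naturality a b φ := by
    ext k x
    refine Subtype.ext ?_
    exact congrArg (fun ψ : d.obj a ⟶ H => ψ.app k x) ((c.naturality φ).trans (Category.comp_id _))

instance {J : Grph.{u}} (d : J.Elements ⥤ Grph.{u}) {H : Grph.{u}}
    (c : d ⟶ (Functor.const J.Elements).obj H) (a : J.Elements) :
    Epi ((toImageDiagram d c).app a) :=
  (Subfunctor.epi_iff_range_eq_top _).2 (Subfunctor.range_toRange (c.app a))

/-- A contraction map injective on edges sends colimit cocones, on diagrams of any shape, to colimit
cocones of images. A cocone on the diagram of images induces a homomorphism out of `G`, which takes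
the same value at the ends of an edge that `f` makes a loop, since some bag contains that edge; so it
is constant on the fibres of `f`, which are connected. -/
theorem IsContraction.nonempty_isColimit_imageCocone {G H : Grph.{u}} {f : G ⟶ H} [Epi f]
    (hf : IsContraction f) (hinj : Function.Injective (emap f)) {J : Grph.{u}}
    {d : J.Elements ⥤ Grph.{u}} {c : d ⟶ (Functor.const J.Elements).obj G}
    (hc : IsColimit (Cocone.mk G c)) :
    Nonempty (IsColimit
      (Cocone.mk H (imageCocone d (c ≫ (Functor.const J.Elements).map f)))) := by
  let cf : d ⟶ (Functor.const J.Elements).obj H := c ≫ (Functor.const J.Elements).map f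
  let t (s : Cocone (imageDiagram d cf)) : Cocone d := ⟨s.pt, toImageDiagram d cf ≫ s.ι⟩
  have hfac : ∀ s a, c.app a ≫ hc.desc (t s) = (toImageDiagram d cf).app a ≫ s.ι.app a :=
    fun s a => hc.fac (t s) a
  have hex : ∀ s : Cocone (imageDiagram d cf), ∃ h : H ⟶ s.pt, f ≫ h = hc.desc (t s) := by
    intro s
    refine exists_comp_eq_of_epi f _ ?_
    rintro (_ | _) x y hxy
    · exact congrArg _ (hinj hxy)
    · refine ((G.preconnected_induce_iff _).1 (hf.connected (vmap f y)).preconnected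
        (fun z => vmap (hc.desc (t s)) x = vmap (hc.desc (t s)) z) (fun e hs ht => ?_)
        x hxy y rfl rfl)
      obtain ⟨a, e, rfl⟩ := exists_app_eq_of_isColimit hc e
      have hval : ∀ z, vmap (hc.desc (t s)) (vmap (c.app a) z) =
          vmap (s.ι.app a) (vmap ((toImageDiagram d cf).app a) z) :=
        fun z => congrArg (fun φ => vmap φ z) (hfac s a)
      have h₁ := vmap_src (c.app a) e
      have h₂ := vmap_tgt (c.app a) e
      have : vmap (hc.desc (t s)) (G.src (emap (c.app a) e)) =
          vmap (hc.desc (t s)) (G.tgt (emap (c.app a) e)) := by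
        refine (congrArg _ h₁.symm).trans ((hval _).trans (Eq.trans ?_
          ((hval _).symm.trans (congrArg _ h₂))))
        refine congrArg _ (Subtype.ext ?_)
        exact (congrArg (vmap f) h₁).trans ((hs.trans ht.symm).trans (congrArg (vmap f) h₂.symm))
      exact (congrArg (fun w => vmap (hc.desc (t s)) x = w) this).to_iff
  refine ⟨⟨fun s => (hex s).choose, fun s a => ?_, fun s m hm => ?_⟩⟩
  · refine (cancel_epi ((toImageDiagram d cf).app a)).1 (Eq.trans ?_ (hfac s a))
    exact congrArg (c.app a ≫ ·) (hex s).choose_spec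
  · refine (cancel_epi f).1 (Eq.trans (hc.hom_ext fun a => ?_) (hex s).choose_spec.symm)
    exact (congrArg ((toImageDiagram d cf).app a ≫ ·) (hm a)).trans (hfac s a).symm

theorem IsContraction.pushesStructuredDecompositions {G H : Grph.{u}} {f : G ⟶ H} [Epi f]
    (hf : IsContraction f) (hinj : Function.Injective (emap f)) (P : Grph.{u} → Prop) :
    PushesStructuredDecompositions P f := fun _ _ d _ hd =>
  ⟨⟨fun _ => inferInstance,
    hd.colimit.elim (hf.nonempty_isColimit_imageCocone hinj)⟩, width_imageDiagram_le d _⟩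

/-! ### Structured decompositions of shape a star -/

/-- The diagram of subgraphs `P`, `Q` at the leaves of the star with two leaves, and `P ⊓ Q` at its
centre and at its edges. -/
def starSubgraph {G : Grph.{u}} (P Q : Subfunctor G) :
    (Grph.star (ULift.{u} Bool)).Elements → Subfunctor G
  | ⟨WalkingParallelPair.one, x⟩ => starFamily P Q (P ⊓ Q) x
  | ⟨WalkingParallelPair.zero, _⟩ => P ⊓ Q

theorem starSubgraph_eq_or_eq_of_hom {G : Grph.{u}} (P Q : Subfunctor G)
    {a b : (Grph.star (ULift.{u} Bool)).Elements} (φ : a ⟶ b) :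
    a = b ∨ starSubgraph P Q a = P ⊓ Q := by
  obtain ⟨_ | _, x⟩ := a
  · exact .inr rfl
  · obtain ⟨_, y⟩ := b
    obtain ⟨φ, h⟩ := φ
    change WalkingParallelPairHom _ _ at φ
    cases φ
    exact .inl (congrArg _ h)

theorem inf_le_starSubgraph {G : Grph.{u}} (P Q : Subfunctor G)
    (a : (Grph.star (ULift.{u} Bool)).Elements) : P ⊓ Q ≤ starSubgraph P Q a := by
  obtain ⟨_ | _, x⟩ := a
  · exact le_rfl
  · obtain _ | ⟨_ | _⟩ := x
    · exact le_rfl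
    · exact inf_le_right
    · exact inf_le_left

theorem starSubgraph_le_of_hom {G : Grph.{u}} (P Q : Subfunctor G)
    {a b : (Grph.star (ULift.{u} Bool)).Elements} (φ : a ⟶ b) :
    starSubgraph P Q a ≤ starSubgraph P Q b := by
  rcases starSubgraph_eq_or_eq_of_hom P Q φ with rfl | h
  · exact le_rfl
  · exact h.le.trans (inf_le_starSubgraph P Q b)

/-- The diagram on the star with two leaves formed by the subgraphs `P`, `Q` and `P ⊓ Q`. -/
def starDiagram {G : Grph.{u}} (P Q : Subfunctor G) :
    (Grph.star (ULift.{u} Bool)).Elements ⥤ Grph.{u} where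
  obj a := (starSubgraph P Q a).toFunctor
  map φ := Subfunctor.homOfLe (starSubgraph_le_of_hom P Q φ)

/-- The cocone of inclusions over the diagram formed by `P`, `Q` and `P ⊓ Q`. -/
def starCocone {G : Grph.{u}} (P Q : Subfunctor G) :
    starDiagram P Q ⟶ (Functor.const _).obj G where
  app a := (starSubgraph P Q a).ι

/-- A leaf of the star with two leaves, as an object of its category of elements. -/
abbrev starLeaf (b : Bool) : (Grph.star (ULift.{u} Bool)).Elements :=
  (Grph.star (ULift.{u} Bool)).elementsMk WalkingParallelPair.one (some ⟨b⟩)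

/-- The values of a cocone over the star diagram are determined by those at the two leaves, and these
agree on `P ⊓ Q`, being both equal to the value at the centre. -/
theorem starDiagram_app_eq {G : Grph.{u}} {P Q : Subfunctor G} (s : Cocone (starDiagram P Q))
    {k : WalkingParallelPair} {x : G.obj k} (a b : (Grph.star (ULift.{u} Bool)).Elements)
    (ha : x ∈ (starSubgraph P Q a).obj k) (hb : x ∈ (starSubgraph P Q b).obj k) :
    (s.ι.app a).app k ⟨x, ha⟩ = (s.ι.app b).app k ⟨x, hb⟩ := by
  let J := Grph.star (ULift.{u} Bool)
  have hw : ∀ {a b : J.Elements} (φ : a ⟶ b) (ha : x ∈ (starSubgraph P Q a).obj k)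
      (hb : x ∈ (starSubgraph P Q b).obj k),
      (s.ι.app a).app k ⟨x, ha⟩ = (s.ι.app b).app k ⟨x, hb⟩ := fun {a b} φ ha hb =>
    (congrArg (fun ψ : (starDiagram P Q).obj a ⟶ s.pt => ψ.app k ⟨x, ha⟩) (s.w φ)).symm
  let centre : J.Elements := J.elementsMk WalkingParallelPair.one none
  have hc : ∀ (a : J.Elements) (ha : x ∈ (starSubgraph P Q a).obj k)
      (hx : x ∈ (P ⊓ Q).obj k), (s.ι.app a).app k ⟨x, ha⟩ = (s.ι.app centre).app k ⟨x, hx⟩ := by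
    rintro ⟨_ | _, y⟩ ha hx
    · exact hw (b := centre) ⟨WalkingParallelPairHom.right, rfl⟩ ha hx
    · obtain _ | y := y
      · rfl
      · let e : J.Elements := J.elementsMk WalkingParallelPair.zero y
        exact (hw (a := e) ⟨WalkingParallelPairHom.left, rfl⟩ hx ha).symm.trans
          (hw (a := e) (b := centre) ⟨WalkingParallelPairHom.right, rfl⟩ hx hx)
  by_cases hx : x ∈ (P ⊓ Q).obj k
  · exact (hc a ha hx).trans (hc b hb hx).symm
  · have hab : a = b := by
      obtain ⟨_ | _, y⟩ := a
      · exact absurd ha hx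
      obtain ⟨_ | _, z⟩ := b
      · exact absurd hb hx
      obtain _ | ⟨_ | _⟩ := y <;> obtain _ | ⟨_ | _⟩ := z
      all_goals first
        | rfl
        | exact absurd ha hx
        | exact absurd hb hx
        | exact absurd (show x ∈ (P ⊓ Q).obj k from ⟨ha, hb⟩) hx
        | exact absurd (show x ∈ (P ⊓ Q).obj k from ⟨hb, ha⟩) hx
    subst hab
    rfl

theorem isStructuredDecomposition_star {G : Grph.{u}} {P Q : Subfunctor G} (hPQ : P ⊔ Q = ⊤) :
    IsStructuredDecomposition (starDiagram P Q) G (starCocone P Q) where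
  mono φ := inferInstanceAs (Mono (Subfunctor.homOfLe (starSubgraph_le_of_hom P Q φ)))
  colimit := by
    have hleaf : ∀ k (x : G.obj k), ∃ b, x ∈ (starSubgraph P Q (starLeaf b)).obj k := by
      intro k x
      have hx : x ∈ (P ⊔ Q).obj k := by rw [hPQ]; trivial
      rcases hx with hx | hx
      · exact ⟨true, hx⟩
      · exact ⟨false, hx⟩
    choose b hb using hleaf
    refine ⟨⟨fun s => ⟨fun k => TypeCat.ofHom fun x =>
      (s.ι.app (starLeaf (b k x))).app k ⟨x, hb k x⟩, fun k l φ => ?_⟩, fun s a => ?_,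
      fun s m hm => ?_⟩⟩
    · ext x
      refine (starDiagram_app_eq s (starLeaf (b l _)) _ (hb l _)
        ((starSubgraph P Q _).map φ (hb k x))).trans ?_
      exact NatTrans.naturality_apply (s.ι.app (starLeaf (b k x))) φ ⟨x, hb k x⟩
    · ext k x
      exact starDiagram_app_eq s _ _ _ x.2
    · ext k x
      exact congrArg (fun ψ : (starDiagram P Q).obj _ ⟶ s.pt => ψ.app k ⟨x, hb k x⟩) (hm _)

/-- If the structured decomposition of `G` into two subgraphs that cover `G` is pushed forward, then
taking images commutes with intersecting these subgraphs. Otherwise the predicate that is true on the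
image of `P` and is membership in the image of `P ⊓ Q` on the image of `Q` would be a cocone over the
diagram of images that does not factor through `H`. -/
theorem image_inf_image_subset {G H : Grph.{u}} {f : G ⟶ H}
    (hf : PushesStructuredDecompositions Grph.IsFiniteTree f) {P Q : Subfunctor G}
    (hPQ : P ⊔ Q = ⊤) (k : WalkingParallelPair) :
    f.app k '' P.obj k ∩ f.app k '' Q.obj k ⊆ f.app k '' (P.obj k ∩ Q.obj k) := by
  rintro y ⟨⟨x, hx, rfl⟩, ⟨x', hx', hxx⟩⟩
  obtain ⟨hc⟩ := (hf _ (Grph.star_isFiniteTree _) _ _ (isStructuredDecomposition_star hPQ)).1.colimit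
  let c := starCocone P Q ≫ (Functor.const _).map f
  let ev := (evaluation WalkingParallelPair (Type u)).obj k
  have hk := isColimitOfPreserves ev hc
  let t : Cocone (imageDiagram (starDiagram P Q) c ⋙ ev) :=
    { pt := ULift.{u} Prop
      ι :=
        { app := fun a => TypeCat.ofHom
            fun w : (Subfunctor.range (c.app a)).obj k =>
              ULift.up (a = starLeaf true ∨ w.1 ∈ f.app k '' (P.obj k ∩ Q.obj k))
          naturality := fun a b φ => by
            ext w
            refine congrArg ULift.up (propext ?_)
            rcases starSubgraph_eq_or_eq_of_hom P Q φ with rfl | h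
            · exact .rfl
            · refine iff_of_true (.inr ?_) (.inr ?_)
              all_goals
                obtain ⟨_, ⟨z, hz⟩, rfl⟩ := w
                exact ⟨z, h.le k hz, rfl⟩ } }
  have hfac : ∀ a (w : (Subfunctor.range (c.app a)).obj k), hk.desc t w.1 =
      ULift.up (a = starLeaf true ∨ w.1 ∈ f.app k '' (P.obj k ∩ Q.obj k)) :=
    fun a w => congrArg (fun ψ : ((imageDiagram (starDiagram P Q) c).obj a).obj k ⟶ t.pt => ψ w)
      (hk.fac t a)
  have h₁ := hfac (starLeaf true) ⟨f.app k x, ⟨⟨x, hx⟩, rfl⟩⟩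
  have h₂ := hfac (starLeaf false) ⟨f.app k x, ⟨⟨x', hx'⟩, hxx⟩⟩
  rcases (ULift.up.inj (h₁.symm.trans h₂)).mp (.inl rfl) with h | h
  · exact absurd (Option.some.inj (eq_of_heq (Sigma.mk.inj h).2)) (by simp)
  · exact h

/-- The subgraph of `G` with vertex set `S` and the edges of `T`, whose ends are in `S`. -/
def Grph.subgraph (G : Grph.{u}) (S : Set G.V) (T : Set G.E)
    (hs : ∀ e ∈ T, G.src e ∈ S) (ht : ∀ e ∈ T, G.tgt e ∈ S) : Subfunctor G where
  obj
    | WalkingParallelPair.zero => T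
    | WalkingParallelPair.one => S
  map := by
    rintro k _ (_ | _ | _) x hx
    · exact hs x hx
    · exact ht x hx
    · have h : G.map (WalkingParallelPairHom.id k) = 𝟙 _ := G.map_id k
      rw [h]
      exact hx

theorem isContraction_of_pushesStructuredDecompositions {G H : Grph.{u}} (f : G ⟶ H) [Epi f]
    (hf : PushesStructuredDecompositions Grph.IsFiniteTree f) : IsContraction f where
  surjective_vertices := app_surjective f _
  surjective_edges := app_surjective f _
  connected := by
    refine connected_fibre_of_separations f (app_surjective f _) fun P Q hPQ he => ?_
    let ind (S : Set G.V) : Subfunctor G :=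
      G.subgraph S {e | G.src e ∈ S ∧ G.tgt e ∈ S} (fun _ h => h.1) fun _ h => h.2
    refine image_inf_image_subset (P := ind P) (Q := ind Q) hf ?_ WalkingParallelPair.one
    ext (_ | _) x
    · exact iff_of_true (he x) trivial
    · exact iff_of_true (hPQ.ge (Set.mem_univ x)) trivial

/-- Pushing structured decompositions forward forces injectivity on edges: an edge `e` and the other
edges in its fibre are separated by the graph without `e` and the graph without the latter. -/
theorem injective_emap_of_pushesStructuredDecompositions {G H : Grph.{u}} (f : G ⟶ H)
    (hf : PushesStructuredDecompositions Grph.IsFiniteTree f) : Function.Injective (emap f) := by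
  intro e e' hee
  by_contra hne
  let sub (T : Set G.E) : Subfunctor G :=
    G.subgraph Set.univ T (fun _ _ => trivial) fun _ _ => trivial
  obtain ⟨w, hw, hwe⟩ := image_inf_image_subset (f := f)
    (P := sub {x | emap f x = emap f e → x = e}) (Q := sub {x | x ≠ e}) hf
    (by
      ext (_ | _) x
      · exact iff_of_true ((em (x = e)).imp (fun h _ => h) id) trivial
      · exact iff_of_true (.inl trivial) trivial)
    WalkingParallelPair.zero
    (show emap f e ∈ _ from ⟨⟨e, fun _ => rfl, rfl⟩, ⟨e', fun h => hne h.symm, hee.symm⟩⟩)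
  exact hw.2 (hw.1 hwe)

end GraphDecomp

theorem mainTheorem3 {G H : GraphDecomp.Grph.{u}} (f : G ⟶ H) (hf : Epi f) :
    [GraphDecomp.IsContraction f,
      GraphDecomp.PushesDecompositions GraphDecomp.Grph.IsTree f,
      GraphDecomp.PushesDecompositions GraphDecomp.Grph.IsFiniteTree f].TFAE ∧
    [GraphDecomp.IsCCContraction f,
      GraphDecomp.IsContraction f ∧ Function.Injective (GraphDecomp.emap f),
      GraphDecomp.PushesStructuredDecompositions GraphDecomp.Grph.IsTree f,
      GraphDecomp.PushesStructuredDecompositions GraphDecomp.Grph.IsFiniteTree f].TFAE ∧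
    (GraphDecomp.IsContraction f → GraphDecomp.treeWidth H ≤ GraphDecomp.treeWidth G) := by
  refine ⟨?_, ?_, fun h => h.treeWidth_le⟩
  · tfae_have 1 → 2 := fun h => h.pushesDecompositions _
    tfae_have 2 → 3 := fun h J hJ => h J hJ.1
    tfae_have 3 → 1 := GraphDecomp.isContraction_of_pushesDecompositions f
    tfae_finish
  · tfae_have 1 → 2 := fun h => ⟨h.isContraction, h.injective_emap⟩
    tfae_have 2 → 1 := fun h => h.1.isCCContraction h.2
    tfae_have 2 → 3 := fun h => h.1.pushesStructuredDecompositions h.2 _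
    tfae_have 3 → 4 := fun h J hJ => h J hJ.1
    tfae_have 4 → 2 := fun h =>
      ⟨GraphDecomp.isContraction_of_pushesStructuredDecompositions f h,
        GraphDecomp.injective_emap_of_pushesStructuredDecompositions f h⟩
    tfae_finish
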